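/- Let $\mathcal X$ be a finite non-empty alphabet, $\mathcal H=\mathbb C^d$ with $d\ge 1$, and $\mathcal V',\mathcal V$ finite alphabets with at least two elements each. Let $(l_n)_{n\in\mathbb N}$ be a sequence of natural numbers that grows linearly, $l_n=\Theta(n)$ (for instance $l_n=n$). For a classical-quantum channel $\rho:\mathcal X\to\mathcal S(\mathcal H)$ (no jammer) and a correlated source $(V',V)$ on $\mathcal V'\times\mathcal V$, call $R\ge 0$ an achievable $((V',V),(l_n))$-correlation assisted common randomness rate if there is a constant $c$ such that for all $\epsilon,\delta>0$ and all sufficiently large $n$ there are: a finite set $\mathcal J$ with $|\mathcal J|\le 2^{cn}$; a random variable $J$ on $\mathcal J$ generated by the sender from $V'^{l_n}$ (and local randomness, so that $J$ and $V^{l_n}$ are conditionally independent given $V'^{l_n}$), where $(V'^{l_n},V^{l_n})$ are $l_n$ i.i.d. copies of $(V',V)$; encoders $u_{v'^{l_n}}:\mathcal J\to\mathcal X^n$; and measurements (POVMs) $\{D_j^{(v^{l_n})}\}_{j\in\mathcal J}$ on $\mathcal H^{\otimes n}$; such that $\frac1n H(J)>R-\delta$ (entropy in bits) and $\Pr\{J\ne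 L\}<\epsilon$, where $L$ is the outcome of the measurement $D^{(V^{l_n})}$ on the channel output $\rho^{\otimes n}(u_{V'^{l_n}}(J))$. Let $\tilde C(\rho,(V',V),(l_n))$ be the supremum of the achievable rates (the $l_n$-limited correlation assisted common randomness capacity). A real-valued function of finitely many real parameters is called Turing computable if there is an algorithm that transforms every rapidly converging Cauchy representation (a program computing rational approximations with error at most $2^{-k}$, $k\in\mathbb N$) of a computable parameter vector in its domain into such a representation of the function's value. Then the function $(\rho,P_{V'V})\mapsto\tilde C(\rho,(V',V),(l_n))$ of the matrix entries of the states $\rho(x)$ and of the probabilities $P_{V'V}(v',v)$ is not Turing computable. Moreover, there is a fixed classical-quantum channel $\rho$ with computable matrix entries for which already $P_{V'V}\mapsto\tilde C(\rho,(V',V),(l_n))$ is not Turing computable. -/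

import Mathlib

open scoped ComplexOrder BigOperators

noncomputable section

namespace CommonRandomness

/-- A classical-quantum channel with input alphabet `X`: a density matrix on `ℂ^ι` for each letter. -/
structure CQChannel (X ι : Type) [Fintype ι] where
  state : X → Matrix ι ι ℂ
  posSemidef : ∀ x, (state x).PosSemidef
  trace_eq_one : ∀ x, (state x).trace = 1

/-- The output `ρ(x₁) ⊗ ⋯ ⊗ ρ(xₙ)` on `(ℂ^ι)^{⊗ n}`, in the product basis indexed by `Fin n → ι`. -/
def CQChannel.tensorState {X ι : Type} [Fintype ι] (ρ : CQChannel X ι) {n : ℕ} (x : Fin n → X) :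
    Matrix (Fin n → ι) (Fin n → ι) ℂ :=
  Matrix.of fun i j => ∏ t, ρ.state (x t) (i t) (j t)

/-- The joint law of one copy of a correlation `(V', V)`; the sender observes the first component
and the receiver the second one. -/
structure CorrelatedSource (V' V : Type) [Fintype V'] [Fintype V] where
  prob : V' → V → ℝ
  nonneg : ∀ v' v, 0 ≤ prob v' v
  sum_eq_one : ∑ v', ∑ v, prob v' v = 1

/-- The joint law of `l` independent copies of `(V', V)`. -/
def CorrelatedSource.blockProb {V' V : Type} [Fintype V'] [Fintype V]
    (P : CorrelatedSource V' V) {l : ℕ} (v' : Fin l → V') (v : Fin l → V) : ℝ :=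
  ∏ t, P.prob (v' t) (v t)

/-- A common randomness generation protocol for `n` channel uses assisted by `l` copies of a
correlation, whose outcome lies in the set `{0, …, M - 1}`. The sender, who sees `v'`, generates
`J` with conditional law `law v'` (so that `J` and the receiver's `V^l` are conditionally
independent given `V'^l`) and sends the codeword `enc v' J`; the receiver, who sees `v`, applies
the measurement `dec v` to the channel output. -/
structure CRCode (X ι V' V : Type) [Fintype ι] [DecidableEq ι] (n l M : ℕ) where
  law : (Fin l → V') → Fin M → ℝ
  law_nonneg : ∀ v' j, 0 ≤ law v' j
  law_sum : ∀ v', ∑ j, law v' j = 1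
  enc : (Fin l → V') → Fin M → Fin n → X
  dec : (Fin l → V) → Fin M → Matrix (Fin n → ι) (Fin n → ι) ℂ
  dec_posSemidef : ∀ v j, (dec v j).PosSemidef
  dec_sum : ∀ v, ∑ j, dec v j = 1

section
variable {X ι V' V : Type} [Fintype ι] [DecidableEq ι] [Fintype V'] [Fintype V] {n l M : ℕ}

/-- The distribution of the sender's random variable `J`. -/
def CRCode.outcomeProb (C : CRCode X ι V' V n l M) (P : CorrelatedSource V' V) (j : Fin M) : ℝ :=
  ∑ v' : Fin l → V', ∑ v : Fin l → V, P.blockProb v' v * C.law v' j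

/-- The Shannon entropy `H(J)` in bits. -/
def CRCode.entropy (C : CRCode X ι V' V n l M) (P : CorrelatedSource V' V) : ℝ :=
  ∑ j, -(C.outcomeProb P j * Real.logb 2 (C.outcomeProb P j))

/-- The probability that the receiver's measurement outcome differs from `J`. -/
def CRCode.errorProb (C : CRCode X ι V' V n l M) (ρ : CQChannel X ι)
    (P : CorrelatedSource V' V) : ℝ :=
  ∑ v' : Fin l → V', ∑ v : Fin l → V, P.blockProb v' v *
    ∑ j, C.law v' j * (1 - (ρ.tensorState (C.enc v' j) * C.dec v j).trace.re)

/-- `R` is an achievable `((V', V), (l_n))`-correlation assisted common randomness rate of the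
classical-quantum channel `ρ`. The number of values of `J` grows at most exponentially in `n`,
with an exponent `c` that does not depend on the error. -/
def IsAchievableRate (ρ : CQChannel X ι) (P : CorrelatedSource V' V) (l : ℕ → ℕ) (R : ℝ) : Prop :=
  0 ≤ R ∧ ∃ c : ℝ, ∀ ε : ℝ, 0 < ε → ∀ δ : ℝ, 0 < δ → ∃ N : ℕ, ∀ n : ℕ, N ≤ n →
    ∃ (M : ℕ) (C : CRCode X ι V' V n (l n) M),
      (M : ℝ) ≤ (2 : ℝ) ^ (c * (n : ℝ)) ∧
      R - δ < C.entropy P / (n : ℝ) ∧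
      C.errorProb ρ P < ε

/-- The `((V', V), (l_n))`-correlation assisted common randomness capacity of `ρ`. -/
def crCapacity (ρ : CQChannel X ι) (P : CorrelatedSource V' V) (l : ℕ → ℕ) : ℝ :=
  sSup {R : ℝ | IsAchievableRate ρ P l R}

end

/-- The rational number `(-1)^s a / b` given by natural numbers `(s, a, b)`. -/
def ratValue (t : ℕ × ℕ × ℕ) : ℝ := (-1) ^ t.1 * (t.2.1 : ℝ) / (t.2.2 : ℝ)

/-- The program `e` is a rapidly converging Cauchy representation of the family of reals `x`: on
input `(i, k)` it halts with a rational number (with nonzero denominator) at distance at most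
`2 ^ (-k)` from `x i`. -/
def IsName {I : Type} [Primcodable I] (x : I → ℝ) (e : Nat.Partrec.Code) : Prop :=
  ∀ (i : I) (k : ℕ), ∃ t : ℕ × ℕ × ℕ,
    Encodable.encode t ∈ e.eval (Encodable.encode (i, k)) ∧
    t.2.2 ≠ 0 ∧ |x i - ratValue t| ≤ (1 / 2 : ℝ) ^ k

/-- All members of the family `x` are computable reals (uniformly in the index). -/
def IsComputableFamily {I : Type} [Primcodable I] (x : I → ℝ) : Prop :=
  ∃ e : Nat.Partrec.Code, IsName x e

/-- Turing (Borel) computability of a real-valued function `f` of objects that are described by the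
real coordinates `coord`: an algorithm transforms each representation of the coordinates of an
object with computable coordinates into a representation of the value of `f`. -/
def IsTuringComputable {D I : Type} [Primcodable I] (coord : D → I → ℝ) (f : D → ℝ) : Prop :=
  ∃ Φ : Nat.Partrec.Code →. Nat.Partrec.Code, Partrec Φ ∧
    ∀ (x : D) (e : Nat.Partrec.Code), IsName (coord x) e →
      ∃ e' ∈ Φ e, IsName (fun _ : Unit => f x) e'

/-- The real and imaginary parts of the matrix entries of the states of a channel. -/
def CQChannel.coord {X ι : Type} [Fintype ι] (ρ : CQChannel X ι) :
    (X × ι × ι) × Bool → ℝ :=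
  fun q => if q.2 then (ρ.state q.1.1 q.1.2.1 q.1.2.2).re else (ρ.state q.1.1 q.1.2.1 q.1.2.2).im

/-- The joint probabilities of a correlation. -/
def CorrelatedSource.coord {V' V : Type} [Fintype V'] [Fintype V] (P : CorrelatedSource V' V) :
    V' × V → ℝ :=
  fun q => P.prob q.1 q.2

/-- The parameters of a channel together with those of a correlation. -/
def pairCoord {X ι V' V : Type} [Fintype ι] [Fintype V'] [Fintype V]
    (p : CQChannel X ι × CorrelatedSource V' V) : ((X × ι × ι) × Bool) ⊕ (V' × V) → ℝ :=
  Sum.elim p.1.coord p.2.coord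

end CommonRandomness

end

noncomputable section

namespace CommonRandomness

open Nat.Partrec (Code)

/-! The capacity jumps, and a function with a jump along a computable path would decide the halting
problem. Take a channel whose output is a fixed pure state, so that nothing is communicated, and as
source a uniform bit together with its copy resampled with probability `t`. At `t = 0` both parties
see the same bits and output them, so the capacity is positive because `l n` grows linearly. For `0
< t` the noise operator on the cube has a spectral gap (Witsenhausen's argument), so parties that
agree with high probability choose a nearly constant value, and the capacity is zero
(`exists_concentrated_of_agree`, `le_of_isAchievableRate`).

To each program one attaches, computably, a name of a real `t` that is positive exactly when the
program halts (`exists_haltingReal`). Approximating the capacity at `t` would then recognise the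
programs that run forever (`not_isTuringComputable_of_jump`). -/

/-! ### Computable names of reals that encode halting. -/

theorem exists_computable_code {α β σ : Type} [Primcodable α] [Primcodable β] [Primcodable σ]
    {r : α → β → σ} (hr : Computable₂ r) :
    ∃ E : α → Code, Computable E ∧
      ∀ a b, Encodable.encode (r a b) ∈ (E a).eval (Encodable.encode b) := by
  have h : Nat.Partrec _ := hr
  obtain ⟨c, hc⟩ := Code.exists_code.1 h
  refine ⟨fun a => Code.curry c (Encodable.encode a),
    (Code.primrec₂_curry.to_comp.comp (Computable.const c) Computable.encode), fun a b => ?_⟩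
  rw [Code.eval_curry, ← Encodable.encode_prod_val, hc]
  simp [Encodable.encodek]

/-- The number of step bounds below `k` within which the program `c` does not halt on `0`. -/
def stallTime (c : Code) (k : ℕ) : ℕ :=
  k.rec 0 fun y r => cond (Code.evaln y c 0).isSome r (r + 1)

theorem computable_stallTime : Computable₂ stallTime := by
  have hstep : Primrec₂ fun (p : Code × ℕ) (q : ℕ × ℕ) =>
      cond (Code.evaln q.1 p.1 0).isSome q.2 (q.2 + 1) := by
    refine Primrec.cond ?_ (Primrec.snd.comp Primrec.snd)
      (Primrec.succ.comp (Primrec.snd.comp Primrec.snd))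
    refine Primrec.option_isSome.comp (Code.primrec_evaln.comp
      (((Primrec.fst.comp Primrec.snd).pair (Primrec.fst.comp Primrec.fst)).pair
        (Primrec.const 0)))
  exact (Primrec.nat_rec' Primrec.snd (Primrec.const 0) hstep).to_comp

theorem stallTime_succ (c : Code) (k : ℕ) :
    stallTime c (k + 1) =
      if (Code.evaln k c 0).isSome then stallTime c k else stallTime c k + 1 := by
  show cond _ _ _ = _
  rw [Bool.cond_eq_ite]
  rfl

theorem exists_evaln_isSome_iff (c : Code) :
    (∃ s, (Code.evaln s c 0).isSome) ↔ (c.eval 0).Dom := by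
  constructor
  · rintro ⟨s, hs⟩
    obtain ⟨x, hx⟩ := Option.isSome_iff_exists.1 hs
    exact Part.dom_iff_mem.2 ⟨x, Code.evaln_sound hx⟩
  · intro h
    obtain ⟨x, hx⟩ := Part.dom_iff_mem.1 h
    obtain ⟨s, hs⟩ := Code.evaln_complete.1 hx
    exact ⟨s, Option.isSome_iff_exists.2 ⟨x, hs⟩⟩

theorem evaln_isSome_mono {c : Code} {s s' : ℕ} (h : s ≤ s')
    (hs : (Code.evaln s c 0).isSome) : (Code.evaln s' c 0).isSome := by
  obtain ⟨x, hx⟩ := Option.isSome_iff_exists.1 hs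
  exact Option.isSome_iff_exists.2 ⟨x, Code.evaln_mono h hx⟩

theorem stallTime_of_not_dom {c : Code} (h : ¬ (c.eval 0).Dom) (k : ℕ) : stallTime c k = k := by
  rw [← exists_evaln_isSome_iff, not_exists] at h
  induction k with
  | zero => rfl
  | succ k ih => rw [stallTime_succ, if_neg (h k), ih]

/-- `evaln` is monotone in the step bound, so the counter freezes at the first bound that suffices.
-/
theorem exists_stallTime_eq_min {c : Code} (h : (c.eval 0).Dom) :
    ∃ s, ∀ k, stallTime c k = min k s := by
  classical
  rw [← exists_evaln_isSome_iff] at h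
  refine ⟨Nat.find h, fun k => ?_⟩
  induction k with
  | zero => simp [stallTime]
  | succ k ih =>
    rw [stallTime_succ, ih]
    split_ifs with hk
    · have := Nat.find_min' h hk
      omega
    · have : ¬ Nat.find h ≤ k := fun hle => hk (evaln_isSome_mono hle (Nat.find_spec h))
      omega

/-- A real number in `[0, 1]` that vanishes if and only if the program `c` runs forever on `0`. -/
theorem exists_haltingReal (c : Code) :
    ∃ t : ℝ, 0 ≤ t ∧ t ≤ 1 ∧ (0 < t ↔ (c.eval 0).Dom) ∧
      ∀ k, |t - (1 / 2) ^ stallTime c k| ≤ (1 / 2) ^ k := by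
  by_cases h : (c.eval 0).Dom
  · obtain ⟨s, hs⟩ := exists_stallTime_eq_min h
    -- With `s` the first sufficient step bound, the approximation is exact from `k = s` on; before
    -- that, both numbers lie in `[0, 2 ^ (-k)]`.
    refine ⟨(1 / 2) ^ s, by positivity, pow_le_one₀ (by norm_num) (by norm_num),
      iff_of_true (by positivity) h, fun k => ?_⟩
    rw [hs]
    rcases le_total k s with hks | hks
    · have h1 : (1 / 2 : ℝ) ^ s ≤ (1 / 2) ^ k :=
        pow_le_pow_of_le_one (by norm_num) (by norm_num) hks
      have h2 : (0 : ℝ) < (1 / 2) ^ s := by positivity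
      rw [min_eq_left hks, abs_le]
      constructor <;> linarith
    · rw [min_eq_right hks, sub_self, abs_zero]
      positivity
  · refine ⟨0, le_rfl, zero_le_one, iff_of_false (lt_irrefl _) h, fun k => ?_⟩
    rw [stallTime_of_not_dom h, zero_sub, abs_neg, abs_of_nonneg (by positivity)]

/-- An affine function of a parameter with coefficients in `ℤ / 4`. -/
structure QuarterAffine where
  const : ℕ
  pos : ℕ
  neg : ℕ
  pos_le : pos ≤ 1
  neg_le : neg ≤ 1
  neg_le_const : neg ≤ const

/-- The value of the affine function at `t`. -/
def QuarterAffine.eval (q : QuarterAffine) (t : ℝ) : ℝ := (q.const + (q.pos - q.neg) * t) / 4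

/-- The value of the affine function at `2 ^ (-s)`, as a fraction. -/
def QuarterAffine.frac (q : QuarterAffine) (s : ℕ) : ℕ × ℕ × ℕ :=
  (0, q.const * 2 ^ s + q.pos - q.neg, 4 * 2 ^ s)

theorem QuarterAffine.ratValue_frac (q : QuarterAffine) (s : ℕ) :
    ratValue (q.frac s) = q.eval ((1 / 2) ^ s) := by
  -- Ensures that the natural subtraction in `frac` does not truncate.
  have h : q.neg ≤ q.const * 2 ^ s + q.pos :=
    (q.neg_le_const.trans (Nat.le_mul_of_pos_right _ (by positivity))).trans (Nat.le_add_right _ _)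
  have h2 : (2 : ℝ) ^ s ≠ 0 := by positivity
  simp only [ratValue, QuarterAffine.frac, QuarterAffine.eval, Nat.cast_sub h]
  push_cast
  rw [one_div, inv_pow]
  field_simp
  ring

/-- The slope has absolute value at most `1 / 4`, so the precision of the parameter passes to every
coordinate unchanged. -/
theorem QuarterAffine.abs_eval_sub_le (q : QuarterAffine) (t t' : ℝ) :
    |q.eval t - q.eval t'| ≤ |t - t'| := by
  have h : q.eval t - q.eval t' = ((q.pos - q.neg : ℝ) / 4) * (t - t') := by
    simp only [QuarterAffine.eval]; ring
  have hp : (q.pos : ℝ) ≤ 1 := by exact_mod_cast q.pos_le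
  have hn : (q.neg : ℝ) ≤ 1 := by exact_mod_cast q.neg_le
  have hp0 : (0 : ℝ) ≤ q.pos := Nat.cast_nonneg _
  have hn0 : (0 : ℝ) ≤ q.neg := Nat.cast_nonneg _
  rw [h, abs_mul]
  refine mul_le_of_le_one_left (abs_nonneg _) (abs_le.2 ⟨?_, ?_⟩) <;> linarith

theorem primrec_two_pow : Primrec fun s : ℕ => 2 ^ s := by
  refine (Primrec.nat_rec₁ 1 (f := fun _ r => r * 2)
    (Primrec.nat_mul.comp Primrec.snd (Primrec.const 2))).of_eq fun s => ?_
  induction s with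
  | zero => rfl
  | succ s ih => simp only [pow_succ, ← ih]

theorem computable_frac {I : Type} [Primcodable I] [Finite I] (q : I → QuarterAffine) :
    Computable₂ fun (c : Code) (p : I × ℕ) => (q p.1).frac (stallTime c p.2) := by
  have hi : Computable fun x : Code × (I × ℕ) => x.2.1 := Computable.fst.comp Computable.snd
  have hs : Computable fun x : Code × (I × ℕ) => 2 ^ stallTime x.1 x.2.2 :=
    primrec_two_pow.to_comp.comp
      (computable_stallTime.comp Computable.fst (Computable.snd.comp Computable.snd))
  -- A function on a finite index type is a lookup table.
  have hI (g : I → ℕ) : Computable g := (Primrec.dom_finite g).to_comp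
  exact (Computable.const 0).pair
    ((Primrec.nat_sub.to_comp.comp
      (Primrec.nat_add.to_comp.comp
        (Primrec.nat_mul.to_comp.comp ((hI fun i => (q i).const).comp hi) hs)
        ((hI fun i => (q i).pos).comp hi))
      ((hI fun i => (q i).neg).comp hi)).pair
      (Primrec.nat_mul.to_comp.comp (Computable.const 4) hs))

theorem isComputableFamily_of_eval {I : Type} [Primcodable I] [Finite I] (q : I → QuarterAffine)
    {x : I → ℝ} (hx : ∀ i, x i = (q i).eval 1) : IsComputableFamily x := by
  have hI (g : I → ℕ) : Computable g := (Primrec.dom_finite g).to_comp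
  -- The parameter `1` is `(1 / 2) ^ 0`, so `frac 0` is an exact value at every precision.
  obtain ⟨E, -, hE⟩ := exists_computable_code
    (r := fun (_ : Unit) (p : I × ℕ) => (q p.1).frac 0)
    ((((Primrec.dom_finite fun i => (q i).frac 0).to_comp.comp
      (Computable.fst.comp Computable.snd))))
  refine ⟨E (), fun i k => ⟨_, hE () (i, k), by simp [QuarterAffine.frac], ?_⟩⟩
  rw [hx, QuarterAffine.ratValue_frac, pow_zero, sub_self, abs_zero]
  positivity

/-! ### From a jump to the halting problem. -/

/-- A rational test separating values close to `0` from values above `4 / K`. -/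
theorem computable_largeTest (K : ℕ) : Computable fun n : ℕ =>
    (((Encodable.decode n : Option (ℕ × ℕ × ℕ)).map fun t =>
      decide (t.1 % 2 = 0 ∧ 2 * t.2.2 < t.2.1 * K)).getD false) := by
  have h : PrimrecPred fun t : ℕ × ℕ × ℕ => t.1 % 2 = 0 ∧ 2 * t.2.2 < t.2.1 * K :=
    PrimrecPred.and
      (Primrec.eq.comp (Primrec.nat_mod.comp Primrec.fst (Primrec.const 2)) (Primrec.const 0))
      (Primrec.nat_lt.comp
        (Primrec.nat_mul.comp (Primrec.const 2) (Primrec.snd.comp Primrec.snd))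
        (Primrec.nat_mul.comp (Primrec.fst.comp Primrec.snd) (Primrec.const K)))
  exact (Primrec.option_getD.comp
    (Primrec.option_map Primrec.decode (h.decide.comp Primrec.snd).to₂)
    (Primrec.const false)).to_comp

/-- The first component matters only through its parity: if odd, the value is nonpositive and the
test must fail; if even, one cross-multiplies. -/
theorem ratValue_test_iff {t : ℕ × ℕ × ℕ} (ht : t.2.2 ≠ 0) {K : ℕ} (hK : 0 < K) :
    (t.1 % 2 = 0 ∧ 2 * t.2.2 < t.2.1 * K) ↔ 2 / (K : ℝ) < ratValue t := by
  obtain ⟨s, a, b⟩ := t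
  have hb : (0 : ℝ) < b := by exact_mod_cast Nat.pos_of_ne_zero ht
  have hK' : (0 : ℝ) < K := by exact_mod_cast hK
  simp only [ratValue]
  rcases Nat.even_or_odd s with hs | hs
  · rw [hs.neg_one_pow, one_mul, div_lt_div_iff₀ hK' hb, and_iff_right (Nat.even_iff.1 hs)]
    exact_mod_cast Iff.rfl
  · refine iff_of_false (fun h => ?_) (not_lt.2 ?_)
    · have := Nat.odd_iff.1 hs
      omega
    · rw [hs.neg_one_pow]
      have h1 : (-1 : ℝ) * a / b ≤ 0 := by
        rw [neg_one_mul, neg_div]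
        exact neg_nonpos.2 (by positivity)
      exact h1.trans (by positivity)

/-- A function with a jump at the parameter `0` of an affine family of objects is not Turing
computable. -/
theorem not_isTuringComputable_of_jump {D I : Type} [Primcodable I] [Finite I]
    {coord : D → I → ℝ} {f : D → ℝ} (x : ℝ → D) (q : I → QuarterAffine)
    (hcoord : ∀ t, 0 ≤ t → t ≤ 1 → ∀ i, coord (x t) i = (q i).eval t)
    (h0 : 0 < f (x 0)) (hpos : ∀ t, 0 < t → t ≤ 1 → f (x t) = 0) :
    ¬ IsTuringComputable coord f := by
  classical
  rintro ⟨Φ, hΦ, hname⟩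
  obtain ⟨E, hE, hEval⟩ := exists_computable_code (computable_frac q)
  -- The reals `t c` are chosen classically; only their names `E c` must depend computably on `c`.
  choose t ht0 ht1 htpos htapprox using exists_haltingReal
  have hxname (c : Code) : IsName (coord (x (t c))) (E c) := fun i k => by
    refine ⟨_, hEval c (i, k), by simp [QuarterAffine.frac], ?_⟩
    rw [hcoord _ (ht0 c) (ht1 c), QuarterAffine.ratValue_frac]
    exact (QuarterAffine.abs_eval_sub_le _ _ _).trans (htapprox c k)
  -- With `4 * 2 ^ (-k) < f (x 0)`, an approximation within `2 ^ (-k)` exceeds `3 * 2 ^ (-k)` at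
  -- parameter `0` and is at most `2 ^ (-k)` at positive ones; the test uses the threshold `2 * 2 ^
  -- (-k)`.
  obtain ⟨k, hk⟩ := exists_pow_lt_of_lt_one (show (0 : ℝ) < f (x 0) / 4 by positivity)
    (show (1 / 2 : ℝ) < 1 by norm_num)
  have hK : (1 / 2 : ℝ) ^ k = 1 / ((2 ^ k : ℕ) : ℝ) := by
    push_cast; rw [one_div_pow]
  let test : ℕ → Bool := fun n => (((Encodable.decode n : Option (ℕ × ℕ × ℕ)).map fun t =>
      decide (t.1 % 2 = 0 ∧ 2 * t.2.2 < t.2.1 * 2 ^ k)).getD false)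
  have htest : Computable test := computable_largeTest (2 ^ k)
  let g : Code →. Bool := fun c =>
    ((Φ (E c)).bind fun e => e.eval (Encodable.encode ((), k))).map test
  have hg : Partrec g := by
    refine Partrec.map ?_ (htest.comp Computable.snd).to₂
    refine Partrec.bind (hΦ.comp hE) ?_
    exact (Code.eval_part.comp Computable.snd (Computable.const _)).to₂
  -- A large value means `t c = 0`, that is, `c` runs forever; so `g` decides non-halting.
  refine ComputablePred.halting_problem_not_re 0 (ComputablePred.to_re ?_)
  refine ⟨inferInstance, hg.of_eq fun c => ?_⟩
  obtain ⟨e, he, hen⟩ := hname _ _ (hxname c)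
  obtain ⟨r, hr, hr0, hrle⟩ := hen () k
  refine Part.eq_some_iff.2 (Part.mem_map_iff _ |>.2 ⟨_, Part.mem_bind_iff.2 ⟨e, he, hr⟩, ?_⟩)
  simp only [test, Encodable.encodek, Option.map_some, Option.getD_some, decide_eq_decide]
  rw [ratValue_test_iff hr0 (by positivity), ← htpos c]
  have h2 : 2 / ((2 ^ k : ℕ) : ℝ) = 2 * (1 / 2) ^ k := by rw [hK]; ring
  rw [h2]
  have hp : (0 : ℝ) < (1 / 2) ^ k := by positivity
  rw [abs_le] at hrle
  constructor
  · intro h hlt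
    rw [hpos _ hlt (ht1 c)] at hrle
    linarith [hrle.1]
  · intro h
    have : t c = 0 := le_antisymm (not_lt.1 h) (ht0 c)
    rw [this] at hrle
    linarith [hrle.2]

/-! ### Entropy of a concentrated distribution. -/

/-- The pointwise form of Gibbs' inequality, from `log x ≤ x - 1` at `x = q / p`; the last term is
nonpositive after summation when `q` has total mass at most that of `p`. -/
theorem logb_inv_le {p q : ℝ} (hp : 0 ≤ p) (hq : 0 < q) :
    -(p * Real.logb 2 p) ≤ p * -Real.logb 2 q + (q - p) / Real.log 2 := by
  have hl : 0 < Real.log 2 := Real.log_pos one_lt_two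
  rcases hp.eq_or_lt with rfl | hp
  · simpa using div_nonneg hq.le hl.le
  have h := Real.log_le_sub_one_of_pos (div_pos hq hp)
  rw [Real.log_div hq.ne' hp.ne'] at h
  have h2 : p * (Real.log q - Real.log p) ≤ q - p := by
    calc _ ≤ p * (q / p - 1) := mul_le_mul_of_nonneg_left h hp.le
      _ = q - p := by field_simp
  have h3 : -(p * Real.logb 2 p) - p * -Real.logb 2 q
      = p * (Real.log q - Real.log p) / Real.log 2 := by
    simp only [Real.logb]; ring
  have h4 := div_le_div_of_nonneg_right h2 hl.le
  linarith

/-- The entropy of a distribution of which all but `ε` is concentrated on the set `S`. -/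
theorem entropy_le_of_concentrated {M : ℕ} {p : Fin M → ℝ} (hp : ∀ j, 0 ≤ p j)
    (hsum : ∑ j, p j = 1) {S : Finset (Fin M)} (hS : S.Nonempty) {ε : ℝ}
    (hpS : 1 - ε ≤ ∑ j ∈ S, p j) :
    ∑ j, -(p j * Real.logb 2 (p j)) ≤ 1 + Real.logb 2 S.card + ε * Real.logb 2 M := by
  have hl : 0 < Real.log 2 := Real.log_pos one_lt_two
  have hMS : S.card ≤ M := by simpa using S.card_le_univ
  have hSc : 0 < S.card := hS.card_pos
  have hM : 0 < M := hSc.trans_le hMS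
  have hSR : (0 : ℝ) < S.card := by exact_mod_cast hSc
  have hMR : (0 : ℝ) < M := by exact_mod_cast hM
  have hlogS : 0 ≤ Real.logb 2 (S.card : ℝ) :=
    Real.logb_nonneg one_lt_two (by exact_mod_cast hSc)
  have hlogM : 0 ≤ Real.logb 2 (M : ℝ) := Real.logb_nonneg one_lt_two (by exact_mod_cast hM)
  -- The comparison weights: half the mass uniform on `S`, the other half dominating a uniform law
  -- off `S`. The factor `2` costs the one bit in the bound.
  let q : Fin M → ℝ := fun j => if j ∈ S then 1 / (2 * S.card) else 1 / (2 * M)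
  have hq (j) : 0 < q j := by
    simp only [q]; split_ifs <;> positivity
  have hqsum : ∑ j, q j ≤ 1 := by
    have h1 (j) : q j ≤ (if j ∈ S then 1 / (2 * (S.card : ℝ)) else 0) + 1 / (2 * M) := by
      simp only [q]
      split_ifs
      · exact le_add_of_nonneg_right (by positivity)
      · rw [zero_add]
    refine (Finset.sum_le_sum fun j _ => h1 j).trans (le_of_eq ?_)
    rw [Finset.sum_add_distrib, Finset.sum_ite_mem, Finset.univ_inter]
    simp only [Finset.sum_const, Finset.card_univ, Fintype.card_fin, nsmul_eq_mul]
    field_simp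
    norm_num
  have hlogq (j) : -Real.logb 2 (q j) ≤
      1 + Real.logb 2 S.card + if j ∈ S then 0 else Real.logb 2 M := by
    have h2 (x : ℝ) (hx : 0 < x) : -Real.logb 2 (1 / (2 * x)) = 1 + Real.logb 2 x := by
      rw [one_div, Real.logb_inv, neg_neg, Real.logb_mul two_ne_zero hx.ne',
        Real.logb_self_eq_one one_lt_two]
    simp only [q]
    split_ifs
    · rw [h2 _ hSR, add_zero]
    · rw [h2 _ hMR]; linarith
  have hcompl : ∑ j, p j * (if j ∈ S then 0 else Real.logb 2 M) ≤ ε * Real.logb 2 M := by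
    have h3 : ∑ j, p j * (if j ∈ S then 0 else Real.logb 2 (M : ℝ)) =
        (1 - ∑ j ∈ S, p j) * Real.logb 2 M := by
      rw [← hsum, sub_mul, Finset.sum_mul, Finset.sum_mul, ← Finset.sum_sdiff S.subset_univ,
        ← Finset.sum_sdiff (f := fun j => p j * Real.logb 2 (M : ℝ)) S.subset_univ,
        add_sub_cancel_right]
      rw [Finset.sum_congr rfl (g := fun j => p j * Real.logb 2 (M : ℝ)) fun j hj => by
          rw [if_neg (Finset.mem_sdiff.1 hj).2],
        Finset.sum_congr (s₁ := S) rfl (g := fun _ => (0 : ℝ)) fun j hj => by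
          rw [if_pos hj, mul_zero]]
      simp
    rw [h3]
    exact mul_le_mul_of_nonneg_right (by linarith) hlogM
  calc ∑ j, -(p j * Real.logb 2 (p j))
      ≤ ∑ j, (p j * (1 + Real.logb 2 S.card) +
          p j * (if j ∈ S then 0 else Real.logb 2 M) + (q j - p j) / Real.log 2) := by
        refine Finset.sum_le_sum fun j _ => (logb_inv_le (hp j) (hq j)).trans ?_
        have := mul_le_mul_of_nonneg_left (hlogq j) (hp j)
        linarith
    _ = (1 + Real.logb 2 S.card) + ∑ j, p j * (if j ∈ S then 0 else Real.logb 2 M) +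
          (∑ j, q j - 1) / Real.log 2 := by
        rw [Finset.sum_add_distrib, Finset.sum_add_distrib, ← Finset.sum_mul, hsum, one_mul,
          ← Finset.sum_div, Finset.sum_sub_distrib, hsum]
    _ ≤ _ := by
        have : (∑ j, q j - 1) / Real.log 2 ≤ 0 :=
          div_nonpos_of_nonpos_of_nonneg (by linarith) hl.le
        linarith

/-! ### Noise on the Boolean cube. -/

/-- The joint law of a uniform bit and the bit obtained from it by resampling with
probability `t`. -/
def bitProb (t : ℝ) (x y : Bool) : ℝ := if x = y then 1 / 2 - t / 4 else t / 4

/-- The joint law of `l` independent pairs of correlated bits. -/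
def bitBlockProb (t : ℝ) {l : ℕ} (x y : Fin l → Bool) : ℝ := ∏ i, bitProb t (x i) (y i)

/-- The average of a function on the Boolean cube. -/
def cubeMean {l : ℕ} (f : (Fin l → Bool) → ℝ) : ℝ := (∑ x, f x) / 2 ^ l

/-- The correlation of `f` and `g` evaluated at `l` independent pairs of correlated bits. -/
def noiseForm (t : ℝ) {l : ℕ} (f g : (Fin l → Bool) → ℝ) : ℝ :=
  ∑ x, ∑ y, bitBlockProb t x y * (f x * g y)

theorem bitBlockProb_comm (t : ℝ) {l : ℕ} (x y : Fin l → Bool) :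
    bitBlockProb t x y = bitBlockProb t y x :=
  Finset.prod_congr rfl fun i _ => by simp only [bitProb, eq_comm]

theorem sum_cube_succ {l : ℕ} (f : (Fin (l + 1) → Bool) → ℝ) :
    ∑ x, f x = ∑ x : Fin l → Bool, (f (Fin.cons true x) + f (Fin.cons false x)) := by
  rw [← (Fin.consEquiv fun _ : Fin (l + 1) => Bool).sum_comp, Fintype.sum_prod_type,
    Fintype.sum_bool, ← Finset.sum_add_distrib]
  rfl

theorem bitBlockProb_cons (t : ℝ) {l : ℕ} (a b : Bool) (x y : Fin l → Bool) :
    bitBlockProb t (Fin.cons a x : Fin (l + 1) → Bool) (Fin.cons b y) =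
      bitProb t a b * bitBlockProb t x y := by
  simp [bitBlockProb, Fin.prod_univ_succ]

/-- The average of `f` over the first bit. -/
def evenPart {l : ℕ} (f : (Fin (l + 1) → Bool) → ℝ) (x : Fin l → Bool) : ℝ :=
  (f (Fin.cons true x) + f (Fin.cons false x)) / 2

/-- Half the difference of `f` over the first bit. -/
def oddPart {l : ℕ} (f : (Fin (l + 1) → Bool) → ℝ) (x : Fin l → Bool) : ℝ :=
  (f (Fin.cons true x) - f (Fin.cons false x)) / 2

/-- The noise on one bit is diagonal in even and odd parts, with eigenvalues `1` and `1 - t`. This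
recursion replaces Fourier analysis on the cube. -/
theorem noiseForm_succ (t : ℝ) {l : ℕ} (f g : (Fin (l + 1) → Bool) → ℝ) :
    noiseForm t f g = noiseForm t (evenPart f) (evenPart g) +
      (1 - t) * noiseForm t (oddPart f) (oddPart g) := by
  simp only [noiseForm, sum_cube_succ, Finset.mul_sum]
  rw [← Finset.sum_add_distrib]
  refine Finset.sum_congr rfl fun x _ => ?_
  rw [← Finset.sum_add_distrib, ← Finset.sum_add_distrib]
  refine Finset.sum_congr rfl fun y _ => ?_
  simp only [bitBlockProb_cons, bitProb, evenPart, oddPart]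
  simp only [if_true, reduceCtorEq, if_false]
  ring

theorem cubeMean_succ {l : ℕ} (f : (Fin (l + 1) → Bool) → ℝ) :
    cubeMean f = cubeMean (evenPart f) := by
  simp only [cubeMean, sum_cube_succ, evenPart, ← Finset.sum_div, pow_succ]
  ring

theorem cubeMean_sq_succ {l : ℕ} (f : (Fin (l + 1) → Bool) → ℝ) :
    cubeMean (fun x => f x ^ 2) =
      cubeMean (fun x => evenPart f x ^ 2) + cubeMean (fun x => oddPart f x ^ 2) := by
  simp only [cubeMean, sum_cube_succ, evenPart, oddPart]
  rw [← add_div, ← Finset.sum_add_distrib, pow_succ, mul_comm _ (2 : ℝ), ← div_div,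
    Finset.sum_div]
  congr 1
  refine Finset.sum_congr rfl fun x _ => ?_
  ring

theorem noiseForm_self_nonneg {t : ℝ} (h1 : t ≤ 1) :
    ∀ {l : ℕ} (f : (Fin l → Bool) → ℝ), 0 ≤ noiseForm t f f
  | 0, f => by
    simp only [noiseForm, Fintype.sum_unique, bitBlockProb, Finset.univ_eq_empty,
      Finset.prod_empty, one_mul]
    exact mul_self_nonneg _
  | l + 1, f => by
    rw [noiseForm_succ]
    exact add_nonneg (noiseForm_self_nonneg h1 _)
      (mul_nonneg (sub_nonneg.2 h1) (noiseForm_self_nonneg h1 _))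

theorem noiseForm_self_le_cubeMean_sq {t : ℝ} (h0 : 0 ≤ t) (h1 : t ≤ 1) :
    ∀ {l : ℕ} (f : (Fin l → Bool) → ℝ), noiseForm t f f ≤ cubeMean fun x => f x ^ 2
  | 0, f => by
    simp [noiseForm, cubeMean, bitBlockProb, sq]
  | l + 1, f => by
    rw [noiseForm_succ, cubeMean_sq_succ]
    refine add_le_add (noiseForm_self_le_cubeMean_sq h0 h1 _) ?_
    exact (mul_le_of_le_one_left (noiseForm_self_nonneg h1 _) (by linarith)).trans
      (noiseForm_self_le_cubeMean_sq h0 h1 _)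

/-- The spectral gap of the noise operator. -/
theorem noiseForm_self_le {t : ℝ} (h0 : 0 ≤ t) (h1 : t ≤ 1) :
    ∀ {l : ℕ} (f : (Fin l → Bool) → ℝ),
      noiseForm t f f ≤ (1 - t) * cubeMean (fun x => f x ^ 2) + t * cubeMean f ^ 2
  | 0, f => by
    simp only [noiseForm, cubeMean, bitBlockProb, Fintype.sum_unique, Finset.univ_eq_empty,
      Finset.prod_empty, pow_zero, div_one]
    exact le_of_eq (by ring)
  | l + 1, f => by
    rw [noiseForm_succ, cubeMean_sq_succ, cubeMean_succ]
    -- The mean of `f` lives in the even part, which takes the induction hypothesis; the odd part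
    -- already carries the factor `1 - t` and needs only contraction.
    have ih := noiseForm_self_le h0 h1 (evenPart f)
    have h := mul_le_mul_of_nonneg_left (noiseForm_self_le_cubeMean_sq h0 h1 (oddPart f))
      (sub_nonneg.2 h1)
    linarith

theorem noiseForm_comm (t : ℝ) {l : ℕ} (f g : (Fin l → Bool) → ℝ) :
    noiseForm t f g = noiseForm t g f := by
  unfold noiseForm
  rw [Finset.sum_comm]
  refine Finset.sum_congr rfl fun x _ => Finset.sum_congr rfl fun y _ => ?_
  rw [bitBlockProb_comm, mul_comm (f y)]

/-- Positivity of the symmetric form at `f - g`. -/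
theorem noiseForm_le_half_add {t : ℝ} (h1 : t ≤ 1) {l : ℕ} (f g : (Fin l → Bool) → ℝ) :
    noiseForm t f g ≤ (noiseForm t f f + noiseForm t g g) / 2 := by
  have h := noiseForm_self_nonneg h1 fun x => f x - g x
  have h2 : noiseForm t (fun x => f x - g x) (fun x => f x - g x) =
      noiseForm t f f - noiseForm t f g - noiseForm t g f + noiseForm t g g := by
    simp only [noiseForm, ← Finset.sum_sub_distrib, ← Finset.sum_add_distrib]
    refine Finset.sum_congr rfl fun x _ => Finset.sum_congr rfl fun y _ => ?_
    ring
  rw [h2, noiseForm_comm t g f] at h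
  linarith

/-- The marginals are uniform whatever `t` is; in the recursion, the constant `1` has no odd part.
-/
theorem noiseForm_one_right (t : ℝ) :
    ∀ {l : ℕ} (f : (Fin l → Bool) → ℝ), noiseForm t f (fun _ => 1) = cubeMean f
  | 0, f => by simp [noiseForm, cubeMean, bitBlockProb]
  | l + 1, f => by
    have he : evenPart (fun _ : Fin (l + 1) → Bool => (1 : ℝ)) = fun _ => 1 := by
      funext x; norm_num [evenPart]
    have ho : oddPart (fun _ : Fin (l + 1) → Bool => (1 : ℝ)) = fun _ => 0 := by
      funext x; norm_num [oddPart]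
    rw [noiseForm_succ, he, ho, noiseForm_one_right t, cubeMean_succ]
    simp [noiseForm]

theorem cubeMean_sum {l : ℕ} {α : Type*} (s : Finset α) (f : α → (Fin l → Bool) → ℝ) :
    ∑ j ∈ s, cubeMean (f j) = cubeMean fun x => ∑ j ∈ s, f j x := by
  simp only [cubeMean, ← Finset.sum_div]
  rw [Finset.sum_comm]

theorem cubeMean_const {l : ℕ} (c : ℝ) : cubeMean (fun _ : Fin l → Bool => c) = c := by
  simp [cubeMean]

theorem cubeMean_mono {l : ℕ} {f g : (Fin l → Bool) → ℝ} (h : ∀ x, f x ≤ g x) :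
    cubeMean f ≤ cubeMean g :=
  div_le_div_of_nonneg_right (Finset.sum_le_sum fun x _ => h x) (by positivity)

theorem cubeMean_nonneg {l : ℕ} {f : (Fin l → Bool) → ℝ} (h : ∀ x, 0 ≤ f x) : 0 ≤ cubeMean f := by
  rw [← cubeMean_const (l := l) 0]
  exact cubeMean_mono h

theorem bitBlockProb_zero {l : ℕ} (x y : Fin l → Bool) :
    bitBlockProb 0 x y = if x = y then (1 / 2) ^ l else 0 := by
  split_ifs with h
  · subst h
    simp [bitBlockProb, bitProb]
  · obtain ⟨i, hi⟩ := Function.ne_iff.1 h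
    exact Finset.prod_eq_zero (Finset.mem_univ i) (by simp [bitProb, hi])

theorem noiseForm_zero {l : ℕ} (f g : (Fin l → Bool) → ℝ) :
    noiseForm 0 f g = cubeMean fun x => f x * g x := by
  simp [noiseForm, cubeMean, bitBlockProb_zero, ← Finset.mul_sum, div_eq_inv_mul]

/-! ### Agreement without communication. -/

/-- Two parties that observe correlated bits and choose the same `j` with high probability choose
a fixed `j` with high probability. -/
theorem exists_concentrated_of_agree {t : ℝ} (h0 : 0 < t) (h1 : t ≤ 1) {l M : ℕ}
    {f g : Fin M → (Fin l → Bool) → ℝ} (hf : ∀ j x, 0 ≤ f j x) (hfs : ∀ x, ∑ j, f j x = 1)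
    (hg : ∀ j x, 0 ≤ g j x) (hgs : ∀ x, ∑ j, g j x = 1) {ε : ℝ}
    (hagree : 1 - ε ≤ ∑ j, noiseForm t (f j) (g j)) :
    ∃ j, 1 - 2 * ε / t ≤ cubeMean (f j) := by
  have hsum {f : Fin M → (Fin l → Bool) → ℝ} (hfs : ∀ x, ∑ j, f j x = 1) :
      ∑ j, cubeMean (f j) = 1 := by
    rw [cubeMean_sum]; simp only [hfs, cubeMean_const]
  have hsq {f : Fin M → (Fin l → Bool) → ℝ} (hf : ∀ j x, 0 ≤ f j x)
      (hfs : ∀ x, ∑ j, f j x = 1) : ∑ j, cubeMean (fun x => f j x ^ 2) ≤ 1 := by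
    rw [← hsum hfs]
    refine Finset.sum_le_sum fun j _ => cubeMean_mono fun x => ?_
    have : f j x ≤ 1 := by
      rw [← hfs x]
      exact Finset.single_le_sum (f := fun j => f j x) (fun j _ => hf j x) (Finset.mem_univ j)
    exact (sq (f j x)).le.trans (mul_le_of_le_one_left (hf j x) this)
  have hM : (Finset.univ : Finset (Fin M)).Nonempty := by
    by_contra h
    rw [Finset.not_nonempty_iff_eq_empty] at h
    have := hfs fun _ => true
    rw [h] at this
    simp at this
  obtain ⟨j, -, hj⟩ := Finset.exists_max_image Finset.univ (fun j => cubeMean (f j)) hM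
  refine ⟨j, ?_⟩
  have hbound : ∑ j, noiseForm t (f j) (g j) ≤
      ∑ j, ((1 - t) * (cubeMean (fun x => f j x ^ 2) + cubeMean (fun x => g j x ^ 2)) +
        t * (cubeMean (f j) ^ 2 + cubeMean (g j) ^ 2)) / 2 :=
    Finset.sum_le_sum fun j _ => by
      have := noiseForm_le_half_add h1 (f j) (g j)
      have := noiseForm_self_le h0.le h1 (f j)
      have := noiseForm_self_le h0.le h1 (g j)
      linarith
  rw [← Finset.sum_div, Finset.sum_add_distrib, ← Finset.mul_sum, ← Finset.mul_sum,
    Finset.sum_add_distrib, Finset.sum_add_distrib] at hbound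
  -- A sum of squares of probabilities is at most the largest one; for `g` the trivial bound `1`
  -- suffices.
  have hpf : ∑ i, cubeMean (f i) ^ 2 ≤ cubeMean (f j) := by
    calc ∑ i, cubeMean (f i) ^ 2 ≤ ∑ i, cubeMean (f j) * cubeMean (f i) :=
          Finset.sum_le_sum fun i _ => by
            rw [sq]
            exact mul_le_mul_of_nonneg_right (hj i (Finset.mem_univ i)) (cubeMean_nonneg (hf i))
      _ = cubeMean (f j) := by rw [← Finset.mul_sum, hsum hfs, mul_one]
  have hpg : ∑ i, cubeMean (g i) ^ 2 ≤ 1 := by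
    rw [← hsum hgs]
    refine Finset.sum_le_sum fun i _ => ?_
    have : cubeMean (g i) ≤ 1 := by
      rw [← hsum hgs]
      exact Finset.single_le_sum (f := fun j => cubeMean (g j))
        (fun j _ => cubeMean_nonneg (hg j)) (Finset.mem_univ i)
    rw [sq]
    exact mul_le_of_le_one_left (cubeMean_nonneg (hg i)) this
  have e1 := mul_le_mul_of_nonneg_left (add_le_add (hsq hf hfs) (hsq hg hgs)) (sub_nonneg.2 h1)
  have e2 := mul_le_mul_of_nonneg_left (add_le_add hpf hpg) h0.le
  -- Altogether `1 - ε ≤ (1 - t) + t * (cubeMean (f j) + 1) / 2`, which is solved for `cubeMean (f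
  -- j)`.
  rw [sub_le_iff_le_add, ← sub_le_iff_le_add', le_div_iff₀ h0]
  linarith

/-- Two parties that observe the same bits and choose the same `j` with high probability choose
an element of a fixed set of at most `2 ^ l` elements with high probability. -/
theorem exists_concentrated_of_agree_zero {l M : ℕ}
    {f g : Fin M → (Fin l → Bool) → ℝ} (hf : ∀ j x, 0 ≤ f j x) (hfs : ∀ x, ∑ j, f j x = 1)
    (hg : ∀ j x, 0 ≤ g j x) (hgs : ∀ x, ∑ j, g j x = 1) {ε : ℝ}
    (hagree : 1 - ε ≤ ∑ j, noiseForm 0 (f j) (g j)) :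
    ∃ S : Finset (Fin M), S.Nonempty ∧ S.card ≤ 2 ^ l ∧ 1 - ε ≤ ∑ j ∈ S, cubeMean (f j) := by
  have hM : (Finset.univ : Finset (Fin M)).Nonempty := by
    by_contra h
    rw [Finset.not_nonempty_iff_eq_empty] at h
    have := hfs fun _ => true
    rw [h] at this
    simp at this
  -- Given the common string `x`, agreement is no more likely than the sender's most likely value `k
  -- x`, and `k` has at most `2 ^ l` values.
  choose k _ hk using fun x => Finset.exists_max_image Finset.univ (fun j => f j x) hM
  refine ⟨Finset.univ.image k, Finset.univ_nonempty.image k, ?_, hagree.trans ?_⟩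
  · refine Finset.card_image_le.trans ?_
    simp
  · simp only [noiseForm_zero]
    rw [cubeMean_sum, cubeMean_sum]
    refine cubeMean_mono fun x => ?_
    calc ∑ j, f j x * g j x ≤ ∑ j, f (k x) x * g j x :=
          Finset.sum_le_sum fun j _ =>
            mul_le_mul_of_nonneg_right (hk x j (Finset.mem_univ j)) (hg j x)
      _ = f (k x) x := by rw [← Finset.mul_sum, hgs, mul_one]
      _ ≤ _ := Finset.single_le_sum (f := fun j => f j x) (fun j _ => hf j x)
          (Finset.mem_image_of_mem k (Finset.mem_univ x))

/-! ### The useless channel. -/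

/-- The channel that outputs the pure basis state `i₀` whatever its input is. -/
def pureChannel (X : Type) {ι : Type} [Fintype ι] [DecidableEq ι] (i₀ : ι) : CQChannel X ι where
  state _ := Matrix.diagonal (Pi.single i₀ 1)
  posSemidef _ := Matrix.PosSemidef.diagonal (Pi.single_nonneg.2 zero_le_one)
  trace_eq_one _ := by simp [Matrix.trace_diagonal]

theorem pureChannel_tensorState {X ι : Type} [Fintype ι] [DecidableEq ι] (i₀ : ι) {n : ℕ}
    (x : Fin n → X) :
    (pureChannel X i₀).tensorState x = Matrix.diagonal (Pi.single (fun _ => i₀) 1) := by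
  ext i j
  simp only [CQChannel.tensorState, pureChannel, Matrix.of_apply]
  by_cases h : i = j
  · subst h
    by_cases hi : i = fun _ => i₀
    · subst hi; simp
    · obtain ⟨t, ht⟩ := Function.ne_iff.1 hi
      rw [Matrix.diagonal_apply_eq, Pi.single_eq_of_ne hi]
      exact Finset.prod_eq_zero (Finset.mem_univ t) (by
        rw [Matrix.diagonal_apply_eq, Pi.single_eq_of_ne ht])
  · obtain ⟨t, ht⟩ := Function.ne_iff.1 h
    rw [Matrix.diagonal_apply_ne _ h]
    exact Finset.prod_eq_zero (Finset.mem_univ t) (Matrix.diagonal_apply_ne _ ht)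

/-- Only one diagonal entry of each measurement operator matters, so the receiver's POVM becomes a
classical random choice depending on `v`. -/
theorem trace_pureChannel_tensorState_mul {X ι : Type} [Fintype ι] [DecidableEq ι] (i₀ : ι) {n : ℕ}
    (x : Fin n → X) (D : Matrix (Fin n → ι) (Fin n → ι) ℂ) :
    ((pureChannel X i₀).tensorState x * D).trace = D (fun _ => i₀) (fun _ => i₀) := by
  rw [pureChannel_tensorState, Matrix.trace]
  simp only [Matrix.diag_apply, Matrix.diagonal_mul]
  rw [Finset.sum_eq_single (fun _ => i₀)]
  · simp
  · intro i _ hi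
    rw [Pi.single_eq_of_ne hi, zero_mul]
  · simp

/-- The coordinates of `pureChannel` as constant functions. -/
def pureCoord {X ι : Type} [DecidableEq ι] (i₀ : ι) (q : (X × ι × ι) × Bool) : QuarterAffine :=
  if q.2 = true ∧ q.1.2.1 = q.1.2.2 ∧ q.1.2.1 = i₀ then ⟨4, 0, 0, by simp, by simp, by simp⟩
  else ⟨0, 0, 0, by simp, by simp, by simp⟩

theorem pureChannel_coord {X ι : Type} [Fintype ι] [DecidableEq ι] (i₀ : ι) (t : ℝ)
    (q : (X × ι × ι) × Bool) : (pureChannel X i₀).coord q = (pureCoord i₀ q).eval t := by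
  obtain ⟨⟨x, i, j⟩, b⟩ := q
  by_cases hij : i = j
  · subst hij
    by_cases hi : i = i₀ <;> cases b <;>
      simp [CQChannel.coord, pureChannel, pureCoord, QuarterAffine.eval, hi]
  · cases b <;> simp [CQChannel.coord, pureChannel, pureCoord, QuarterAffine.eval, hij]

/-! ### Correlated bits inside larger alphabets. -/

/-- The two letters of `Fin n` that stand for the two values of a bit. -/
def embedBit {n : ℕ} (hn : 2 ≤ n) (x : Bool) : Fin n := if x then ⟨0, by omega⟩ else ⟨1, by omega⟩

/-- The bit that a letter stands for. -/
def bitOf {n : ℕ} (i : Fin n) : Bool := decide (i.val = 0)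

@[simp]
theorem bitOf_embedBit {n : ℕ} (hn : 2 ≤ n) (x : Bool) : bitOf (embedBit hn x) = x := by
  cases x <;> simp [bitOf, embedBit]

theorem embedBit_injective {n : ℕ} (hn : 2 ≤ n) : Function.Injective (embedBit hn) :=
  Function.LeftInverse.injective (bitOf_embedBit hn)

theorem embedBit_lt {n : ℕ} (hn : 2 ≤ n) (x : Bool) : (embedBit hn x).val < 2 := by
  cases x <;> simp [embedBit]

theorem not_lt_two_of_notMem_range {n : ℕ} (hn : 2 ≤ n) {i : Fin n}
    (hi : i ∉ Set.range (embedBit hn)) : ¬ i.val < 2 := by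
  intro h
  apply hi
  have : i.val = 0 ∨ i.val = 1 := by omega
  rcases this with h | h
  · exact ⟨true, Fin.ext (by simp [embedBit, h])⟩
  · exact ⟨false, Fin.ext (by simp [embedBit, h])⟩

/-- The law of a pair of correlated bits on larger alphabets. -/
def letterProb {a b : ℕ} (t : ℝ) (i : Fin a) (j : Fin b) : ℝ :=
  if i.val < 2 ∧ j.val < 2 then bitProb t (bitOf i) (bitOf j) else 0

theorem letterProb_embedBit {a b : ℕ} (ha : 2 ≤ a) (hb : 2 ≤ b) (t : ℝ) (x y : Bool) :
    letterProb t (embedBit ha x) (embedBit hb y) = bitProb t x y := by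
  rw [letterProb, if_pos ⟨embedBit_lt ha x, embedBit_lt hb y⟩, bitOf_embedBit, bitOf_embedBit]

/-- A word containing a letter other than the two bit letters has probability zero, so expectations
over source blocks become sums over the cube. -/
theorem sum_prod_letterProb {a b : ℕ} (ha : 2 ≤ a) (hb : 2 ≤ b) (t : ℝ) {l : ℕ}
    (F : (Fin l → Fin a) → (Fin l → Fin b) → ℝ) :
    ∑ v', ∑ v, (∏ s, letterProb t (v' s) (v s)) * F v' v =
      ∑ x : Fin l → Bool, ∑ y : Fin l → Bool,
        bitBlockProb t x y * F (embedBit ha ∘ x) (embedBit hb ∘ y) := by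
  have hex {n : ℕ} (hn : 2 ≤ n) {v : Fin l → Fin n}
      (hv : v ∉ Set.range fun x : Fin l → Bool => embedBit hn ∘ x) : ∃ s, ¬ (v s).val < 2 := by
    by_contra! h
    apply hv
    have hr (s : Fin l) : v s ∈ Set.range (embedBit hn) := by
      by_contra hs
      exact not_lt_two_of_notMem_range hn hs (h s)
    choose x hx using hr
    exact ⟨x, funext hx⟩
  symm
  refine Fintype.sum_of_injective _ (embedBit_injective ha).comp_left _ _ (fun v' hv' => ?_)
    fun x => ?_
  · obtain ⟨s, hs⟩ := hex ha hv'
    refine Finset.sum_eq_zero fun v _ => ?_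
    rw [Finset.prod_eq_zero (Finset.mem_univ s) (if_neg fun h => hs h.1), zero_mul]
  · refine Fintype.sum_of_injective _ (embedBit_injective hb).comp_left _ _ (fun v hv => ?_)
      fun y => ?_
    · obtain ⟨s, hs⟩ := hex hb hv
      rw [Finset.prod_eq_zero (Finset.mem_univ s) (if_neg fun h => hs h.2), zero_mul]
    · simp only [Function.comp_apply, letterProb_embedBit, bitBlockProb]

theorem sum_letterProb {a b : ℕ} (ha : 2 ≤ a) (hb : 2 ≤ b) (t : ℝ) :
    ∑ i : Fin a, ∑ j : Fin b, letterProb t i j = 1 := by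
  rw [← Fintype.sum_of_injective (embedBit ha) (embedBit_injective ha)
    (fun x => ∑ y, bitProb t x y) _ (fun i hi => ?_) fun x => ?_]
  · simp only [Fintype.sum_bool, bitProb]
    simp only [if_true, reduceCtorEq, if_false]
    ring
  · exact Finset.sum_eq_zero fun j _ => if_neg fun h => not_lt_two_of_notMem_range ha hi h.1
  · exact Fintype.sum_of_injective (embedBit hb) (embedBit_injective hb) _ _
      (fun j hj => if_neg fun h => not_lt_two_of_notMem_range hb hj h.2)
      fun y => (letterProb_embedBit ha hb t x y).symm

/-- A uniform bit and its resampling with probability `t` (clamped to `[0, 1]`). -/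
def bitSource {a b : ℕ} (ha : 2 ≤ a) (hb : 2 ≤ b) (t : ℝ) : CorrelatedSource (Fin a) (Fin b) where
  prob := letterProb (max 0 (min t 1))
  nonneg i j := by
    have h0 : 0 ≤ max 0 (min t 1) := le_max_left _ _
    have h1 : max 0 (min t 1) ≤ 1 := max_le zero_le_one (min_le_right _ _)
    unfold letterProb bitProb
    split_ifs <;> linarith
  sum_eq_one := sum_letterProb ha hb _

theorem bitSource_prob {a b : ℕ} (ha : 2 ≤ a) (hb : 2 ≤ b) {t : ℝ} (h0 : 0 ≤ t) (h1 : t ≤ 1) :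
    (bitSource ha hb t).prob = letterProb t := by
  simp only [bitSource, min_eq_left h1, max_eq_right h0]

/-- The coordinates of `bitSource` as affine functions of the resampling probability. -/
def bitCoord {a b : ℕ} (q : Fin a × Fin b) : QuarterAffine :=
  if q.1.val < 2 ∧ q.2.val < 2 then
    if bitOf q.1 = bitOf q.2 then ⟨2, 0, 1, by simp, by simp, by simp⟩
    else ⟨0, 1, 0, by simp, by simp, by simp⟩
  else ⟨0, 0, 0, by simp, by simp, by simp⟩

theorem bitSource_coord {a b : ℕ} (ha : 2 ≤ a) (hb : 2 ≤ b) {t : ℝ} (h0 : 0 ≤ t) (h1 : t ≤ 1)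
    (q : Fin a × Fin b) : (bitSource ha hb t).coord q = (bitCoord q).eval t := by
  simp only [CorrelatedSource.coord, bitSource_prob ha hb h0 h1, letterProb, bitProb, bitCoord]
  split_ifs <;> simp only [QuarterAffine.eval] <;> push_cast <;> ring

/-! ### Codes as families of functions on the cube. -/

section
variable {X ι : Type} [Fintype ι] [DecidableEq ι] {n l M a b : ℕ}

/-- The law of `J` given the sender's bits. -/
def bitLaw (C : CRCode X ι (Fin a) (Fin b) n l M) (ha : 2 ≤ a) (j : Fin M) (x : Fin l → Bool) : ℝ :=
  C.law (embedBit ha ∘ x) j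

/-- The law of the outcome of the measurement given the receiver's bits. -/
def bitDec (C : CRCode X ι (Fin a) (Fin b) n l M) (i₀ : ι) (hb : 2 ≤ b) (j : Fin M)
    (y : Fin l → Bool) : ℝ :=
  (C.dec (embedBit hb ∘ y) j (fun _ => i₀) (fun _ => i₀)).re

theorem bitLaw_nonneg (C : CRCode X ι (Fin a) (Fin b) n l M) (ha : 2 ≤ a) (j : Fin M)
    (x : Fin l → Bool) : 0 ≤ bitLaw C ha j x := C.law_nonneg _ _

theorem bitLaw_sum (C : CRCode X ι (Fin a) (Fin b) n l M) (ha : 2 ≤ a) (x : Fin l → Bool) :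
    ∑ j, bitLaw C ha j x = 1 := C.law_sum _

theorem bitDec_nonneg (C : CRCode X ι (Fin a) (Fin b) n l M) (i₀ : ι) (hb : 2 ≤ b) (j : Fin M)
    (y : Fin l → Bool) : 0 ≤ bitDec C i₀ hb j y :=
  (Complex.le_def.1 ((C.dec_posSemidef (embedBit hb ∘ y) j).diag_nonneg (i := fun _ => i₀))).1

theorem bitDec_sum (C : CRCode X ι (Fin a) (Fin b) n l M) (i₀ : ι) (hb : 2 ≤ b)
    (y : Fin l → Bool) : ∑ j, bitDec C i₀ hb j y = 1 := by
  have h := congrFun (congrFun (C.dec_sum (embedBit hb ∘ y)) (fun _ => i₀)) (fun _ => i₀)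
  rw [Matrix.sum_apply, Matrix.one_apply_eq] at h
  have h2 := congrArg Complex.re h
  rwa [Complex.re_sum, Complex.one_re] at h2

theorem outcomeProb_bitSource (C : CRCode X ι (Fin a) (Fin b) n l M) (ha : 2 ≤ a) (hb : 2 ≤ b)
    {t : ℝ} (h0 : 0 ≤ t) (h1 : t ≤ 1) (j : Fin M) :
    C.outcomeProb (bitSource ha hb t) j = cubeMean (bitLaw C ha j) := by
  simp only [CRCode.outcomeProb, CorrelatedSource.blockProb, bitSource_prob ha hb h0 h1]
  rw [sum_prod_letterProb ha hb t fun v' _ => C.law v' j, ← noiseForm_one_right t]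
  simp only [noiseForm, bitLaw, mul_one]

theorem errorProb_bitSource (C : CRCode X ι (Fin a) (Fin b) n l M) (i₀ : ι) (ha : 2 ≤ a)
    (hb : 2 ≤ b) {t : ℝ} (h0 : 0 ≤ t) (h1 : t ≤ 1) :
    C.errorProb (pureChannel X i₀) (bitSource ha hb t) =
      1 - ∑ j, noiseForm t (bitLaw C ha j) (bitDec C i₀ hb j) := by
  simp only [CRCode.errorProb, CorrelatedSource.blockProb, bitSource_prob ha hb h0 h1,
    trace_pureChannel_tensorState_mul]
  rw [sum_prod_letterProb ha hb t fun v' v =>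
    ∑ j, C.law v' j * (1 - (C.dec v j (fun _ => i₀) (fun _ => i₀)).re)]
  -- Writing the total mass as a noise form lets the two sides be compared term by term in `x` and
  -- `y`.
  have hone : noiseForm t (fun _ : Fin l → Bool => 1) (fun _ => 1) = 1 := by
    rw [noiseForm_one_right, cubeMean_const]
  conv_rhs => rw [← hone]
  simp only [noiseForm]
  rw [Finset.sum_comm (s := (Finset.univ : Finset (Fin M))), ← Finset.sum_sub_distrib]
  refine Finset.sum_congr rfl fun x _ => ?_
  rw [Finset.sum_comm (s := (Finset.univ : Finset (Fin M))), ← Finset.sum_sub_distrib]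
  refine Finset.sum_congr rfl fun y _ => ?_
  rw [← Finset.mul_sum, ← mul_sub]
  congr 1
  simp only [mul_sub, mul_one, Finset.sum_sub_distrib, C.law_sum, bitLaw, bitDec]

end

/-! ### Upper bounds on achievable rates. -/

/-- A rate is at most `κ` if the outcome of every good code is concentrated on a set of about
`2 ^ (κ n)` elements. -/
theorem le_of_isAchievableRate {X ι V' V : Type} [Fintype ι] [DecidableEq ι] [Fintype V']
    [Fintype V] {ρ : CQChannel X ι} {P : CorrelatedSource V' V} {l : ℕ → ℕ} {R κ A : ℝ}
    (hA : 0 < A) (hR : IsAchievableRate ρ P l R)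
    (hS : ∃ N₀ : ℕ, ∀ n, N₀ ≤ n → ∀ (M : ℕ) (C : CRCode X ι V' V n (l n) M) (ε : ℝ),
      C.errorProb ρ P < ε → (∀ j, 0 ≤ C.outcomeProb P j) ∧ ∑ j, C.outcomeProb P j = 1 ∧
        ∃ S : Finset (Fin M), S.Nonempty ∧ Real.logb 2 S.card ≤ κ * n ∧
          1 - A * ε ≤ ∑ j ∈ S, C.outcomeProb P j) : R ≤ κ := by
  by_contra! hlt
  obtain ⟨-, c, hc⟩ := hR
  obtain ⟨N₀, hS⟩ := hS
  have hη : 0 < R - κ := sub_pos.2 hlt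
  have hc' : 0 < |c| + 1 := by positivity
  -- As `M ≤ 2 ^ (c * n)`, this error keeps the entropy outside `S` below `(R - κ) / 4 * n`. It
  -- relies on `c` being independent of the error.
  have hε : 0 < (R - κ) / (4 * A * (|c| + 1)) := by positivity
  obtain ⟨N, hN⟩ := hc _ hε ((R - κ) / 4) (by positivity)
  -- For `n > 4 / (R - κ)` the extra bit is also below a quarter of the gap, so the entropy exceeds
  -- `κ * n` by less than half the gap, while the rate demands three quarters.
  obtain ⟨n, hn⟩ := exists_nat_gt (max (N + N₀ : ℝ) (4 / (R - κ)))
  obtain ⟨hn1, hn2⟩ := max_lt_iff.1 hn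
  have hn1' : N + N₀ < n := by exact_mod_cast hn1
  have hnpos : (0 : ℝ) < n := by
    have : 0 < n := by omega
    exact_mod_cast this
  obtain ⟨M, C, hM, hent, herr⟩ := hN n (by omega)
  obtain ⟨hp, hsum, S, hSne, hScard, hSp⟩ := hS n (by omega) M C _ herr
  have h1 := entropy_le_of_concentrated hp hsum hSne hSp
  have hMpos : (0 : ℝ) < M := by
    have : 0 < M := hSne.card_pos.trans_le (by simpa using S.card_le_univ)
    exact_mod_cast this
  have hlogM : Real.logb 2 M ≤ (|c| + 1) * n := by
    rw [Real.logb_le_iff_le_rpow one_lt_two hMpos]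
    refine hM.trans (Real.rpow_le_rpow_of_exponent_le one_le_two ?_)
    exact mul_le_mul_of_nonneg_right ((le_abs_self c).trans (by linarith)) hnpos.le
  have h2 : A * ((R - κ) / (4 * A * (|c| + 1))) * Real.logb 2 M ≤ (R - κ) / 4 * n := by
    refine (mul_le_mul_of_nonneg_left hlogM (by positivity)).trans (le_of_eq ?_)
    field_simp
  rw [lt_div_iff₀ hnpos] at hent
  rw [div_lt_iff₀ hη] at hn2
  have h3 : C.entropy P ≤ 1 + κ * n + (R - κ) / 4 * n := by
    unfold CRCode.entropy
    linarith
  nlinarith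

section
variable {X ι : Type} [Fintype ι] [DecidableEq ι] {a b : ℕ}

theorem outcomeProb_bitSource_law {n l M : ℕ} (C : CRCode X ι (Fin a) (Fin b) n l M) (ha : 2 ≤ a)
    (hb : 2 ≤ b) {t : ℝ} (h0 : 0 ≤ t) (h1 : t ≤ 1) :
    (∀ j, 0 ≤ C.outcomeProb (bitSource ha hb t) j) ∧
      ∑ j, C.outcomeProb (bitSource ha hb t) j = 1 := by
  simp only [outcomeProb_bitSource C ha hb h0 h1]
  refine ⟨fun j => cubeMean_nonneg (bitLaw_nonneg C ha j), ?_⟩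
  rw [cubeMean_sum]
  simp only [bitLaw_sum, cubeMean_const]

theorem isAchievableRate_bitSource_le_zero (i₀ : ι) (ha : 2 ≤ a) (hb : 2 ≤ b) {t : ℝ} (h0 : 0 < t)
    (h1 : t ≤ 1) {l : ℕ → ℕ} {R : ℝ}
    (hR : IsAchievableRate (pureChannel X i₀) (bitSource ha hb t) l R) : R ≤ 0 := by
  -- The factor `2 / t` comes from `exists_concentrated_of_agree`; the singleton there has logarithm
  -- `0`, which gives `κ = 0`.
  refine le_of_isAchievableRate (A := 2 / t) (by positivity) hR ⟨0, fun n _ M C ε hε => ?_⟩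
  obtain ⟨hp, hsum⟩ := outcomeProb_bitSource_law C ha hb h0.le h1
  rw [errorProb_bitSource C i₀ ha hb h0.le h1] at hε
  obtain ⟨j, hj⟩ := exists_concentrated_of_agree h0 h1 (bitLaw_nonneg C ha) (bitLaw_sum C ha)
    (bitDec_nonneg C i₀ hb) (bitDec_sum C i₀ hb) (ε := ε) (by linarith)
  refine ⟨hp, hsum, {j}, Finset.singleton_nonempty j, by simp, ?_⟩
  rw [Finset.sum_singleton, outcomeProb_bitSource C ha hb h0.le h1]
  exact hj.trans' (le_of_eq (by ring))

/-- This bounds the set of rates: the real `sSup` of an unbounded set is `0` by convention, so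
without it the capacity at `t = 0` could not be shown positive. -/
theorem isAchievableRate_bitSource_zero_le (i₀ : ι) (ha : 2 ≤ a) (hb : 2 ≤ b) {l : ℕ → ℕ} {K : ℝ}
    (hl : ∃ N : ℕ, ∀ n, N ≤ n → (l n : ℝ) ≤ K * n) {R : ℝ}
    (hR : IsAchievableRate (pureChannel X i₀) (bitSource ha hb 0) l R) : R ≤ K := by
  obtain ⟨N, hl⟩ := hl
  refine le_of_isAchievableRate (A := 1) one_pos hR ⟨N, fun n hn M C ε hε => ?_⟩
  obtain ⟨hp, hsum⟩ := outcomeProb_bitSource_law C ha hb le_rfl zero_le_one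
  rw [errorProb_bitSource C i₀ ha hb le_rfl zero_le_one] at hε
  obtain ⟨S, hS, hcard, hSp⟩ := exists_concentrated_of_agree_zero (bitLaw_nonneg C ha)
    (bitLaw_sum C ha) (bitDec_nonneg C i₀ hb) (bitDec_sum C i₀ hb) (ε := ε) (by linarith)
  refine ⟨hp, hsum, S, hS, (hl n hn).trans' ?_, ?_⟩
  · rw [Real.logb_le_iff_le_rpow one_lt_two (by exact_mod_cast hS.card_pos), Real.rpow_natCast]
    exact_mod_cast hcard
  · simp only [outcomeProb_bitSource C ha hb le_rfl zero_le_one, one_mul]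
    exact hSp

/-! ### The copying protocol and the values of the capacity. -/

/-- The bit strings of length `l`, numbered. -/
def cubeEquiv (l : ℕ) : (Fin l → Bool) ≃ Fin (2 ^ l) := Fintype.equivFinOfCardEq (by simp)

/-- The protocol in which both parties output their bits and the channel is not used. -/
def copyCode (ι : Type) [Fintype ι] [DecidableEq ι] (a b : ℕ) (x₀ : X) (n l : ℕ) :
    CRCode X ι (Fin a) (Fin b) n l (2 ^ l) where
  law v' j := if j = cubeEquiv l (bitOf ∘ v') then 1 else 0
  law_nonneg v' j := by split_ifs <;> norm_num
  law_sum v' := by simp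
  enc _ _ _ := x₀
  dec v j := if j = cubeEquiv l (bitOf ∘ v) then 1 else 0
  dec_posSemidef v j := by
    split_ifs
    · exact Matrix.PosSemidef.one
    · exact Matrix.PosSemidef.zero
  dec_sum v := by simp

theorem bitOf_comp_embedBit_comp {n l : ℕ} (hn : 2 ≤ n) (x : Fin l → Bool) :
    bitOf ∘ embedBit hn ∘ x = x :=
  funext fun s => bitOf_embedBit hn (x s)

theorem copyCode_bitLaw (ha : 2 ≤ a) (x₀ : X) (n l : ℕ) (j : Fin (2 ^ l)) (x : Fin l → Bool) :
    bitLaw (copyCode ι a b x₀ n l) ha j x = if j = cubeEquiv l x then 1 else 0 := by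
  simp only [bitLaw, copyCode, bitOf_comp_embedBit_comp]

theorem copyCode_bitDec (i₀ : ι) (hb : 2 ≤ b) (x₀ : X) (n l : ℕ) (j : Fin (2 ^ l))
    (y : Fin l → Bool) :
    bitDec (copyCode ι a b x₀ n l) i₀ hb j y = if j = cubeEquiv l y then 1 else 0 := by
  simp only [bitDec, copyCode, bitOf_comp_embedBit_comp]
  split_ifs <;> simp

theorem copyCode_errorProb (i₀ : ι) (ha : 2 ≤ a) (hb : 2 ≤ b) (x₀ : X) (n l : ℕ) :
    (copyCode ι a b x₀ n l).errorProb (pureChannel X i₀) (bitSource ha hb 0) = 0 := by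
  rw [errorProb_bitSource _ i₀ ha hb le_rfl zero_le_one]
  simp only [noiseForm_zero, cubeMean_sum, copyCode_bitLaw, copyCode_bitDec]
  simp [cubeMean_const]

theorem copyCode_entropy (ha : 2 ≤ a) (hb : 2 ≤ b) (x₀ : X) (n l : ℕ) :
    (copyCode ι a b x₀ n l).entropy (bitSource ha hb 0) = l := by
  have h (j : Fin (2 ^ l)) : (copyCode ι a b x₀ n l).outcomeProb (bitSource ha hb 0) j =
      ((2 : ℝ) ^ l)⁻¹ := by
    rw [outcomeProb_bitSource _ ha hb le_rfl zero_le_one]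
    simp only [cubeMean, copyCode_bitLaw, ← Equiv.symm_apply_eq]
    simp
  simp only [CRCode.entropy, h, Real.logb_inv, Real.logb_pow, Real.logb_self_eq_one one_lt_two]
  simp

/-- Copying gives `l n` perfectly shared uniform bits. The lower bound on `l` yields the rate, the
upper bound the exponent `K` for the number of outcomes. -/
theorem isAchievableRate_bitSource_zero (i₀ : ι) (ha : 2 ≤ a) (hb : 2 ≤ b) (x₀ : X) {l : ℕ → ℕ}
    {k K : ℝ} (hk : 0 ≤ k) (hlk : ∃ N : ℕ, ∀ n : ℕ, N ≤ n → k * n ≤ l n)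
    (hlK : ∃ N : ℕ, ∀ n : ℕ, N ≤ n → (l n : ℝ) ≤ K * n) :
    IsAchievableRate (pureChannel X i₀) (bitSource ha hb 0) l k := by
  obtain ⟨N₁, hN₁⟩ := hlk
  obtain ⟨N₂, hN₂⟩ := hlK
  -- The summand `1` excludes `n = 0`, where the division is degenerate.
  refine ⟨hk, K, fun ε hε δ hδ => ⟨N₁ + N₂ + 1, fun n hn =>
    ⟨2 ^ l n, copyCode ι a b x₀ n (l n), ?_, ?_, ?_⟩⟩⟩
  · push_cast
    rw [← Real.rpow_natCast]
    exact Real.rpow_le_rpow_of_exponent_le one_le_two (hN₂ n (by omega))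
  · have hnpos : (0 : ℝ) < n := by
      have : 0 < n := by omega
      exact_mod_cast this
    rw [copyCode_entropy, lt_div_iff₀ hnpos]
    have := hN₁ n (by omega)
    nlinarith
  · rwa [copyCode_errorProb]

/-- No protocol has to be exhibited: rates are nonnegative by definition, and `sSup` of the empty
set is `0` as well. -/
theorem crCapacity_bitSource_eq_zero (i₀ : ι) (ha : 2 ≤ a) (hb : 2 ≤ b) {t : ℝ} (h0 : 0 < t)
    (h1 : t ≤ 1) (l : ℕ → ℕ) : crCapacity (pureChannel X i₀) (bitSource ha hb t) l = 0 :=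
  le_antisymm (Real.sSup_nonpos fun _ hR => isAchievableRate_bitSource_le_zero i₀ ha hb h0 h1 hR)
    (Real.sSup_nonneg fun _ hR => hR.1)

theorem crCapacity_bitSource_zero_pos (i₀ : ι) (ha : 2 ≤ a) (hb : 2 ≤ b) (x₀ : X) {l : ℕ → ℕ}
    (hl : Asymptotics.IsTheta Filter.atTop (fun n => (l n : ℝ)) (fun n => (n : ℝ))) :
    0 < crCapacity (pureChannel X i₀) (bitSource ha hb 0) l := by
  obtain ⟨K, hK⟩ := hl.1.bound
  obtain ⟨k, hkpos, hk⟩ := hl.2.exists_pos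
  have hK' : ∃ N : ℕ, ∀ n, N ≤ n → (l n : ℝ) ≤ K * n := by
    simpa using Filter.eventually_atTop.1 hK
  have hk' : ∃ N : ℕ, ∀ n : ℕ, N ≤ n → k⁻¹ * n ≤ l n := by
    obtain ⟨N, hN⟩ := Filter.eventually_atTop.1 hk.bound
    refine ⟨N, fun n hn => ?_⟩
    rw [inv_mul_le_iff₀ hkpos]
    simpa using hN n hn
  exact (inv_pos.2 hkpos).trans_le (le_csSup
    ⟨K, fun R hR => isAchievableRate_bitSource_zero_le i₀ ha hb hK' hR⟩
    (isAchievableRate_bitSource_zero i₀ ha hb x₀ (inv_nonneg.2 hkpos.le) hk' hK'))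

end

end CommonRandomness

end

/-! ### The theorem: the jump applied to the pair and to the source alone. -/

theorem mainTheorem10 (m d a b : ℕ) (hm : 1 ≤ m) (hd : 1 ≤ d) (ha : 2 ≤ a) (hb : 2 ≤ b)
    (l : ℕ → ℕ) (hl : Asymptotics.IsTheta Filter.atTop (fun n => (l n : ℝ)) (fun n => (n : ℝ))) :
    (¬ CommonRandomness.IsTuringComputable CommonRandomness.pairCoord
      (fun p : CommonRandomness.CQChannel (Fin m) (Fin d) ×
          CommonRandomness.CorrelatedSource (Fin a) (Fin b) =>
        CommonRandomness.crCapacity p.1 p.2 l)) ∧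
    ∃ ρ : CommonRandomness.CQChannel (Fin m) (Fin d),
      CommonRandomness.IsComputableFamily ρ.coord ∧
      ¬ CommonRandomness.IsTuringComputable CommonRandomness.CorrelatedSource.coord
        (fun P : CommonRandomness.CorrelatedSource (Fin a) (Fin b) =>
          CommonRandomness.crCapacity ρ P l) := by
  let i₀ : Fin d := ⟨0, hd⟩
  let ρ := CommonRandomness.pureChannel (Fin m) i₀
  have hpos := CommonRandomness.crCapacity_bitSource_zero_pos i₀ ha hb (⟨0, hm⟩ : Fin m) hl
  have hzero (t : ℝ) (h0 : 0 < t) (h1 : t ≤ 1) :=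
    CommonRandomness.crCapacity_bitSource_eq_zero (X := Fin m) i₀ ha hb h0 h1 l
  refine ⟨CommonRandomness.not_isTuringComputable_of_jump
      (fun t => (ρ, CommonRandomness.bitSource ha hb t))
      (Sum.elim (CommonRandomness.pureCoord i₀) CommonRandomness.bitCoord) ?_ hpos hzero,
    ρ, CommonRandomness.isComputableFamily_of_eval _ (CommonRandomness.pureChannel_coord i₀ 1),
    CommonRandomness.not_isTuringComputable_of_jump (CommonRandomness.bitSource ha hb)
      CommonRandomness.bitCoord
      (fun t h0 h1 => CommonRandomness.bitSource_coord ha hb h0 h1) hpos hzero⟩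
  rintro t h0 h1 (q | q)
  · exact CommonRandomness.pureChannel_coord i₀ t q
  · exact CommonRandomness.bitSource_coord ha hb h0 h1 q
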